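/- Let $M$ be a smooth manifold of dimension at least $7$ with a smooth Riemannian metric $g$ and Levi-Civita connection $\nabla$, and let $(g,\varphi,\xi,\eta)$ be an almost contact metric structure on $M$. That is, $\varphi$ is a smooth $(1,1)$-tensor field, $\xi$ a smooth vector field and $\eta$ a smooth $1$-form such that $$\varphi^2=-\mathrm{id}+\xi\otimes\eta,\qquad \eta(X)=g(X,\xi),\qquad g(\xi,\xi)=1,\qquad g(\varphi X,Y)=-g(X,\varphi Y)$$ for all vector fields $X,Y$. Suppose that the structure is nearly Sasakian, i.e. that $$(\nabla_X\varphi)X=g(X,X)\,\xi-\eta(X)\,X$$ for all vector fields $X$. Then it is Sasakian, i.e. $$(\nabla_X\varphi)Y=g(X,Y)\,\xi-\eta(Y)\,X$$ for all vector fields $X,Y$. -/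

import Mathlib

open Bundle FiberBundle VectorField
open scoped Manifold ContDiff

noncomputable section

section LeviCivita

variable {E : Type*} [NormedAddCommGroup E] [NormedSpace ℝ E]
  {H : Type*} [TopologicalSpace H] {I : ModelWithCorners ℝ E H}
  {M : Type*} [TopologicalSpace M] [ChartedSpace H M]

/-- The value of `g(∇_X Y, Z)` at the point `x` prescribed by the Koszul formula
`2 g(∇_X Y, Z) = X g(Y, Z) + Y g(X, Z) - Z g(X, Y) + g([X, Y], Z) - g([X, Z], Y) - g([Y, Z], X)`. -/
def koszul [RiemannianBundle (fun x : M => TangentSpace I x)]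
    (X Y Z : Π x : M, TangentSpace I x) (x : M) : ℝ :=
  (1 / 2 : ℝ) *
    (d% (fun y => inner ℝ (Y y) (Z y)) x (X x)
      + d% (fun y => inner ℝ (X y) (Z y)) x (Y x)
      - d% (fun y => inner ℝ (X y) (Y y)) x (Z x)
      + inner ℝ (mlieBracket I X Y x) (Z x)
      - inner ℝ (mlieBracket I X Z x) (Y x)
      - inner ℝ (mlieBracket I Y Z x) (X x))

theorem mdifferentiableAt_inner_field [IsManifold I ∞ M]
    [RiemannianBundle (fun x : M => TangentSpace I x)]
    [IsContMDiffRiemannianBundle I ∞ E (fun x : M => TangentSpace I x)]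
    {X Y : Π x : M, TangentSpace I x} {x : M}
    (hX : MDiffAt (T% X) x) (hY : MDiffAt (T% Y) x) :
    MDiffAt (fun y => inner ℝ (X y) (Y y)) x :=
  MDifferentiableAt.inner_bundle (F := E) (E := fun x : M => TangentSpace I x) (v := X) (w := Y)
    (b := fun x => x) hX hY

variable [FiniteDimensional ℝ E] [RiemannianBundle (fun x : M => TangentSpace I x)]

/-- The endomorphism of `T_x M` that represents a bilinear form with respect to the metric:
`g(metricRaise B u, w) = B u w`. -/
def metricRaise {x : M} (B : TangentSpace I x →L[ℝ] TangentSpace I x →L[ℝ] ℝ) :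
    TangentSpace I x →L[ℝ] TangentSpace I x :=
  have : FiniteDimensional ℝ (TangentSpace I x) := inferInstanceAs (FiniteDimensional ℝ E)
  have : CompleteSpace (TangentSpace I x) := FiniteDimensional.complete ℝ _
  LinearMap.toContinuousLinearMap
    { toFun := fun u => (InnerProductSpace.toDual ℝ (TangentSpace I x)).symm (B u)
      map_add' := fun u v => by simp
      map_smul' := fun c u => by simp }

theorem inner_metricRaise {x : M} (B : TangentSpace I x →L[ℝ] TangentSpace I x →L[ℝ] ℝ)
    (u w : TangentSpace I x) : inner ℝ (metricRaise B u) w = B u w := by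
  have : FiniteDimensional ℝ (TangentSpace I x) := inferInstanceAs (FiniteDimensional ℝ E)
  have : CompleteSpace (TangentSpace I x) := FiniteDimensional.complete ℝ _
  exact InnerProductSpace.toDual_symm_apply (𝕜 := ℝ) (E := TangentSpace I x) (x := w) (y := B u)

variable [IsManifold I ∞ M]
  [IsContMDiffRiemannianBundle I ∞ E (fun x : M => TangentSpace I x)]

theorem koszul_tensorial_left {Y Z : Π x : M, TangentSpace I x} {x : M}
    (hY : MDiffAt (T% Y) x) (hZ : MDiffAt (T% Z) x) :
    TensorialAt I E (fun X => koszul X Y Z x) x := by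
  have : CompleteSpace E := FiniteDimensional.complete ℝ E
  constructor
  · intro f X hf hX
    have h1 := mvfderiv_fun_mul hf (mdifferentiableAt_inner_field hX hZ)
    have h2 := mvfderiv_fun_mul hf (mdifferentiableAt_inner_field hX hY)
    simp [koszul, inner_smul_left, h1, h2, mlieBracket_smul_left hf hX, inner_add_left,
      inner_smul_right]
    ring
  · intro X X' hX hX'
    have h1 := mvfderiv_fun_add (mdifferentiableAt_inner_field hX hZ)
      (mdifferentiableAt_inner_field hX' hZ)
    have h2 := mvfderiv_fun_add (mdifferentiableAt_inner_field hX hY)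
      (mdifferentiableAt_inner_field hX' hY)
    simp [koszul, inner_add_left, h1, h2, mlieBracket_add_left hX hX', inner_add_right]
    ring

theorem koszul_tensorial_right {X Y : Π x : M, TangentSpace I x} {x : M}
    (hX : MDiffAt (T% X) x) (hY : MDiffAt (T% Y) x) :
    TensorialAt I E (fun Z => koszul X Y Z x) x := by
  have : CompleteSpace E := FiniteDimensional.complete ℝ E
  constructor
  · intro f Z hf hZ
    have h1 := mvfderiv_fun_mul hf (mdifferentiableAt_inner_field hX hZ)
    have h2 := mvfderiv_fun_mul hf (mdifferentiableAt_inner_field hY hZ)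
    simp [koszul, inner_smul_left, h1, h2, mlieBracket_smul_right hf hZ, inner_add_left,
      inner_smul_right]
    rw [real_inner_comm (Y x) (Z x), real_inner_comm (X x) (Z x)]
    ring
  · intro Z Z' hZ hZ'
    have h1 := mvfderiv_fun_add (mdifferentiableAt_inner_field hX hZ)
      (mdifferentiableAt_inner_field hX hZ')
    have h2 := mvfderiv_fun_add (mdifferentiableAt_inner_field hY hZ)
      (mdifferentiableAt_inner_field hY hZ')
    simp [koszul, inner_add_left, h1, h2, mlieBracket_add_right hZ hZ', inner_add_right]
    ring

theorem koszul_add {X Y Y' Z : Π x : M, TangentSpace I x} {x : M}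
    (hX : MDiffAt (T% X) x) (hY : MDiffAt (T% Y) x) (hY' : MDiffAt (T% Y') x)
    (hZ : MDiffAt (T% Z) x) :
    koszul X (Y + Y') Z x = koszul X Y Z x + koszul X Y' Z x := by
  have : CompleteSpace E := FiniteDimensional.complete ℝ E
  have h1 := mvfderiv_fun_add (mdifferentiableAt_inner_field hY hZ)
    (mdifferentiableAt_inner_field hY' hZ)
  have h2 := mvfderiv_fun_add (mdifferentiableAt_inner_field hX hY)
    (mdifferentiableAt_inner_field hX hY')
  simp [koszul, inner_add_left, h1, h2, mlieBracket_add_left hY hY',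
    mlieBracket_add_right hY hY', inner_add_right]
  ring

theorem koszul_smul {X Y Z : Π x : M, TangentSpace I x} {f : M → ℝ} {x : M}
    (hX : MDiffAt (T% X) x) (hY : MDiffAt (T% Y) x) (hf : MDiffAt f x)
    (hZ : MDiffAt (T% Z) x) :
    koszul X (f • Y) Z x = f x * koszul X Y Z x + d% f x (X x) * inner ℝ (Y x) (Z x) := by
  have : CompleteSpace E := FiniteDimensional.complete ℝ E
  have h1 := mvfderiv_fun_mul hf (mdifferentiableAt_inner_field hY hZ)
  have h2 := mvfderiv_fun_mul hf (mdifferentiableAt_inner_field hX hY)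
  simp [koszul, inner_smul_left, h1, h2, mlieBracket_smul_left hf hY,
    mlieBracket_smul_right hf hY, inner_add_left, inner_smul_right]
  rw [real_inner_comm (X x) (Y x)]
  ring

/-- For a vector field `Y` differentiable at `x`, the bilinear form `(u, w) ↦ g(∇_u Y, w)` on
`T_x M` given by the Koszul formula. -/
def koszulForm {Y : Π x : M, TangentSpace I x} {x : M} (hY : MDiffAt (T% Y) x) :
    TangentSpace I x →L[ℝ] TangentSpace I x →L[ℝ] ℝ :=
  TensorialAt.mkHom₂ (F := E) (F' := E) (fun X Z => koszul X Y Z x) x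
    (fun _ hZ => koszul_tensorial_left hY hZ) (fun _ hX => koszul_tensorial_right hX hY)

theorem koszulForm_apply {X Y Z : Π x : M, TangentSpace I x} {x : M} (hX : MDiffAt (T% X) x)
    (hY : MDiffAt (T% Y) x) (hZ : MDiffAt (T% Z) x) :
    koszulForm hY (X x) (Z x) = koszul X Y Z x :=
  TensorialAt.mkHom₂_apply _ _ hX hZ

open Classical in
/-- The underlying map of the Levi-Civita connection. -/
def leviCivitaFun (Y : Π x : M, TangentSpace I x) (x : M) :
    TangentSpace I x →L[ℝ] TangentSpace I x :=
  if hY : MDiffAt (T% Y) x then metricRaise (koszulForm hY) else 0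

theorem inner_leviCivitaFun {X Y Z : Π x : M, TangentSpace I x} {x : M} (hX : MDiffAt (T% X) x)
    (hY : MDiffAt (T% Y) x) (hZ : MDiffAt (T% Z) x) :
    inner ℝ (leviCivitaFun Y x (X x)) (Z x) = koszul X Y Z x := by
  rw [leviCivitaFun, dif_pos hY, inner_metricRaise, koszulForm_apply hX hY hZ]

variable (I M) in
/-- The Levi-Civita connection of the Riemannian metric of `M`, as a covariant derivative on the
tangent bundle: `leviCivita I M Y x v` is `∇_v Y`. -/
def leviCivita : CovariantDerivative I E (fun x : M => TangentSpace I x) where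
  toFun := leviCivitaFun
  isCovariantDerivativeOnUniv :=
    { add := by
        intro Y Y' x hY hY' _
        ext u
        refine ext_inner_right ℝ fun w => ?_
        have hu := mdifferentiableAt_extend I E u
        have hw := mdifferentiableAt_extend I E w
        have h := koszul_add hu hY hY' hw
        rw [← inner_leviCivitaFun hu (mdifferentiableAt_add_section hY hY') hw,
          ← inner_leviCivitaFun hu hY hw, ← inner_leviCivitaFun hu hY' hw] at h
        simpa [inner_add_left] using h
      leibniz := by
        intro Y f x hY hf _
        ext u
        refine ext_inner_right ℝ fun w => ?_
        have hu := mdifferentiableAt_extend I E u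
        have hw := mdifferentiableAt_extend I E w
        have h := koszul_smul hu hY hf hw
        rw [← inner_leviCivitaFun hu (hf.smul_section hY) hw,
          ← inner_leviCivitaFun hu hY hw] at h
        simpa [inner_add_left, inner_smul_left] using h }

theorem inner_leviCivita {X Y Z : Π x : M, TangentSpace I x} {x : M} (hX : MDiffAt (T% X) x)
    (hY : MDiffAt (T% Y) x) (hZ : MDiffAt (T% Z) x) :
    inner ℝ (leviCivita I M Y x (X x)) (Z x) = koszul X Y Z x :=
  inner_leviCivitaFun hX hY hZ

/-- The Levi-Civita connection is compatible with the metric. -/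
theorem leviCivita_metric {Y Z : Π x : M, TangentSpace I x} {x : M}
    (hY : MDiffAt (T% Y) x) (hZ : MDiffAt (T% Z) x) (u : TangentSpace I x) :
    d% (fun y => inner ℝ (Y y) (Z y)) x u
      = inner ℝ (leviCivita I M Y x u) (Z x) + inner ℝ (Y x) (leviCivita I M Z x u) := by
  have hu := mdifferentiableAt_extend I E u
  have h1 := inner_leviCivita hu hY hZ
  have h2 := inner_leviCivita hu hZ hY
  rw [extend_apply_self] at h1 h2
  rw [real_inner_comm (leviCivita I M Z x u) (Y x), h1, h2]
  have hc : (fun y => inner ℝ (Z y) (Y y)) = fun y => inner ℝ (Y y) (Z y) := by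
    funext y
    exact real_inner_comm _ _
  have hs : mlieBracket I Z Y x = -mlieBracket I Y Z x := mlieBracket_swap_apply
  simp [koszul, hc, hs]
  ring

/-- The Levi-Civita connection is torsion-free. -/
theorem leviCivita_torsion_free {X Y : Π x : M, TangentSpace I x} {x : M}
    (hX : MDiffAt (T% X) x) (hY : MDiffAt (T% Y) x) :
    leviCivita I M Y x (X x) - leviCivita I M X x (Y x) = mlieBracket I X Y x := by
  refine ext_inner_right ℝ fun w => ?_
  have hw := mdifferentiableAt_extend I E w
  have h1 := inner_leviCivita hX hY hw
  have h2 := inner_leviCivita hY hX hw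
  rw [extend_apply_self] at h1 h2
  rw [inner_sub_left, h1, h2]
  have hc : (fun y => inner ℝ (Y y) (X y)) = fun y => inner ℝ (X y) (Y y) := by
    funext y
    exact real_inner_comm _ _
  have hs : mlieBracket I Y X x = -mlieBracket I X Y x := mlieBracket_swap_apply
  simp [koszul, hc, hs]
  ring

end LeviCivita

section AlmostContact

variable {E : Type*} [NormedAddCommGroup E] [NormedSpace ℝ E]
  {H : Type*} [TopologicalSpace H] (I : ModelWithCorners ℝ E H)
  (M : Type*) [TopologicalSpace M] [ChartedSpace H M] [IsManifold I ∞ M]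
  [RiemannianBundle (fun x : M => TangentSpace I x)]

/-- An almost contact metric structure `(g, φ, ξ, η)` on `M`, where `g` is the given Riemannian
metric on the tangent bundle of `M`. -/
structure AlmostContactMetricStructure where
  /-- the smooth `(1,1)`-tensor field `φ` -/
  φ : Π x : M, TangentSpace I x →L[ℝ] TangentSpace I x
  /-- the smooth vector field `ξ` -/
  ξ : Π x : M, TangentSpace I x
  /-- the smooth one-form `η` -/
  η : Π x : M, TangentSpace I x →L[ℝ] ℝ
  contMDiff_φ : ContMDiff I (I.prod 𝓘(ℝ, E →L[ℝ] E)) ∞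
    (fun x => TotalSpace.mk' (E →L[ℝ] E)
      (E := fun x : M => TangentSpace I x →L[ℝ] TangentSpace I x) x (φ x))
  contMDiff_ξ : ContMDiff I (I.prod 𝓘(ℝ, E)) ∞
    (fun x => TotalSpace.mk' E (E := fun x : M => TangentSpace I x) x (ξ x))
  contMDiff_η : ContMDiff I (I.prod 𝓘(ℝ, E →L[ℝ] ℝ)) ∞
    (fun x => TotalSpace.mk' (E →L[ℝ] ℝ)
      (E := fun x : M => TangentSpace I x →L[ℝ] ℝ) x (η x))
  φ_sq : ∀ (x : M) (v : TangentSpace I x), φ x (φ x v) = -v + η x v • ξ x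
  η_eq : ∀ (x : M) (v : TangentSpace I x), η x v = inner ℝ v (ξ x)
  inner_ξ_ξ : ∀ x : M, inner ℝ (ξ x) (ξ x) = 1
  φ_skew : ∀ (x : M) (v w : TangentSpace I x), inner ℝ (φ x v) w = -inner ℝ v (φ x w)

namespace AlmostContactMetricStructure

variable {I M} (S : AlmostContactMetricStructure I M)

theorem mdifferentiableAt_φ_apply {Y : Π x : M, TangentSpace I x} {x : M}
    (hY : MDiffAt (T% Y) x) : MDiffAt (T% (fun y => S.φ y (Y y))) x :=
  MDifferentiableAt.clm_bundle_apply (F₁ := E) (F₂ := E) (E₁ := fun x : M => TangentSpace I x)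
    (E₂ := fun x : M => TangentSpace I x) (b := fun x => x) (ϕ := S.φ) (v := Y)
    (S.contMDiff_φ.mdifferentiableAt (by simp)) hY

variable [FiniteDimensional ℝ E]
  [IsContMDiffRiemannianBundle I ∞ E (fun x : M => TangentSpace I x)]

/-- The covariant derivative `∇φ` with respect to the Levi-Civita connection:
`S.nablaφ x v w` is `(∇_v φ) w`, where `(∇_X φ) Y = ∇_X (φ Y) - φ (∇_X Y)` for vector fields. -/
def nablaφ (x : M) : TangentSpace I x →L[ℝ] TangentSpace I x →L[ℝ] TangentSpace I x :=
  TensorialAt.mkHom₂ (F := E) (F' := E)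
    (fun X Y : Π x : M, TangentSpace I x =>
      leviCivita I M (fun y => S.φ y (Y y)) x (X x) - S.φ x (leviCivita I M Y x (X x))) x
    (fun Y _ =>
      { smul := by
          intro f X _ _
          simp [smul_sub]
        add := by
          intro X X' _ _
          simp
          abel })
    (fun X _ =>
      { smul := by
          intro f Y hf hY
          have h1 := (leviCivita I M).isCovariantDerivativeOn.leibniz
            (S.mdifferentiableAt_φ_apply hY) hf (Set.mem_univ x)
          have h2 := (leviCivita I M).isCovariantDerivativeOn.leibniz hY hf (Set.mem_univ x)
          have h3 : (fun y => S.φ y ((f • Y) y)) = f • fun y => S.φ y (Y y) := by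
            funext y
            simp
          rw [h3, h1, h2]
          simp [smul_sub]
        add := by
          intro Y Y' hY hY'
          have h1 := (leviCivita I M).isCovariantDerivativeOn.add
            (S.mdifferentiableAt_φ_apply hY) (S.mdifferentiableAt_φ_apply hY') (Set.mem_univ x)
          have h2 := (leviCivita I M).isCovariantDerivativeOn.add hY hY' (Set.mem_univ x)
          have h3 : (fun y => S.φ y ((Y + Y') y))
              = (fun y => S.φ y (Y y)) + fun y => S.φ y (Y' y) := by
            funext y
            simp
          rw [h3, h1, h2]
          simp
          abel })

theorem nablaφ_apply {X Y : Π x : M, TangentSpace I x} {x : M} (hX : MDiffAt (T% X) x)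
    (hY : MDiffAt (T% Y) x) :
    S.nablaφ x (X x) (Y x)
      = leviCivita I M (fun y => S.φ y (Y y)) x (X x) - S.φ x (leviCivita I M Y x (X x)) :=
  TensorialAt.mkHom₂_apply _ _ hX hY

/-- The structure is nearly Sasakian: `(∇_X φ) X = g(X, X) ξ - η(X) X`. -/
def IsNearlySasakian : Prop :=
  ∀ (x : M) (v : TangentSpace I x), S.nablaφ x v v = inner ℝ v v • S.ξ x - S.η x v • v

/-- The structure is Sasakian: `(∇_X φ) Y = g(X, Y) ξ - η(Y) X`. -/
def IsSasakian : Prop :=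
  ∀ (x : M) (v w : TangentSpace I x), S.nablaφ x v w = inner ℝ v w • S.ξ x - S.η x w • v

end AlmostContactMetricStructure

end AlmostContact

end

/-! Write T(X, Y) = (∇_X φ)Y − g(X, Y)ξ + η(Y)X (`defect`). The hypothesis makes T alternating, and
since φ is skew, g(T(·,·),·) is a 3-form; the claim is T = 0. Its vertical part T(ξ, ·) equals φh,
where h = ∇ξ + φ is skew and anticommutes with φ. In particular ξ is Killing.

Curvature enters through the Ricci identity for φ. Alternated with Bianchi, it shows that the 3-form
is closed (`defect_closed`), and closedness in turn says that φ, acting as a derivation, annihilates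
the Riemann tensor (`φrm_add_φrm`). By Kostant's formula R(·,·)ξ is ∇∇ξ, so φ annihilates ∇∇ξ. On
ξ^⊥ the derivation φ acts on trilinear forms with eigenvalues ±i ± i ± i, never 0, so the horizontal
part of ∇∇ξ vanishes (`metric_connConnξ_φ_φ_φ`). Thus ∇h and T agree horizontally; differentiating
hφ = −φh, and then the relation hT = 0, removes the horizontal part of T (`horDefect_eq_zero`).

What is left of T is built from η and g(φh·,·), and closedness becomes the vanishing on ξ^⊥ of the
wedge of g(∇ξ·,·) with g(φh·,·) (`wedge_eq_zero`). In dimension greater than 5 there is U ≠ 0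
orthogonal to ξ, Z, φZ, hZ, φhZ; evaluating on (U, φU, Z, φhZ) leaves |U|²|φhZ|² = 0. So φh = 0, and
T = 0.

The computation is purely formal, over a ring of functions in which 2 and 3 can be cancelled;
positivity of the metric and point evaluation are the only other inputs. -/

noncomputable section

/-! ### Formal Levi-Civita calculus and the symmetries of the Riemann tensor -/

section LeviCivitaAlgebra

/-- A module `L` of vector fields over a ring `C` of functions, with a metric and its Levi-Civita
connection: `der X f` is the derivative of `f` along `X` and `conn X Y` is `∇_X Y`. -/
structure LeviCivitaAlgebra (C L : Type*) [CommRing C] [AddCommGroup L] [Module C L] where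
  /-- the derivative of a function along a vector field -/
  der : L → C → C
  /-- the covariant derivative of a vector field along a vector field -/
  conn : L → L → L
  /-- the metric -/
  metric : L →ₗ[C] L →ₗ[C] C
  der_add : ∀ X f f', der X (f + f') = der X f + der X f'
  der_one : ∀ X, der X 1 = 0
  conn_add_left : ∀ X X' Y, conn (X + X') Y = conn X Y + conn X' Y
  conn_smul_left : ∀ (f : C) X Y, conn (f • X) Y = f • conn X Y
  conn_add_right : ∀ X Y Y', conn X (Y + Y') = conn X Y + conn X Y'
  conn_smul_right : ∀ X (f : C) Y, conn X (f • Y) = der X f • Y + f • conn X Y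
  metric_symm : ∀ X Y, metric X Y = metric Y X
  metric_definite : ∀ X, metric X X = 0 → X = 0
  der_metric : ∀ X Y Z, der X (metric Y Z) = metric (conn X Y) Z + metric Y (conn X Z)
  der_commutator : ∀ X Y f,
    der X (der Y f) - der Y (der X f) = der (conn X Y - conn Y X) f
  jacobi : ∀ X Y Z,
    conn X (conn Y Z - conn Z Y) - conn (conn Y Z - conn Z Y) X
      + (conn Y (conn Z X - conn X Z) - conn (conn Z X - conn X Z) Y)
      + (conn Z (conn X Y - conn Y X) - conn (conn X Y - conn Y X) Z) = 0

namespace LeviCivitaAlgebra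

variable {C L : Type*} [CommRing C] [AddCommGroup L] [Module C L] (N : LeviCivitaAlgebra C L)

local notation "⟪" X ", " Y "⟫" => N.metric X Y
local notation "∇" => N.conn

theorem der_zero (X : L) : N.der X 0 = 0 := by
  simpa using N.der_add X 0 0

theorem der_neg (X : L) (f : C) : N.der X (-f) = -N.der X f := by
  have h := N.der_add X f (-f)
  rw [add_neg_cancel, N.der_zero] at h
  linear_combination -h

theorem conn_neg_left (X Y : L) : ∇ (-X) Y = -∇ X Y := by
  simpa using N.conn_smul_left (-1) X Y

theorem conn_sub_left (X X' Y : L) : ∇ (X - X') Y = ∇ X Y - ∇ X' Y := by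
  rw [sub_eq_add_neg, N.conn_add_left, N.conn_neg_left, ← sub_eq_add_neg]

theorem conn_zero_right (X : L) : ∇ X 0 = 0 := by
  simpa using N.conn_add_right X 0 0

theorem conn_neg_right (X Y : L) : ∇ X (-Y) = -∇ X Y := by
  have h := N.conn_add_right X Y (-Y)
  rw [add_neg_cancel, N.conn_zero_right] at h
  exact (neg_eq_of_add_eq_zero_right h.symm).symm

theorem conn_sub_right (X Y Y' : L) : ∇ X (Y - Y') = ∇ X Y - ∇ X Y' := by
  rw [sub_eq_add_neg, N.conn_add_right, N.conn_neg_right, ← sub_eq_add_neg]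

theorem ext_metric {X Y : L} (h : ∀ Z, ⟪X, Z⟫ = ⟪Y, Z⟫) : X = Y := by
  refine sub_eq_zero.mp (N.metric_definite _ ?_)
  rw [map_sub N.metric, LinearMap.sub_apply, h, sub_self]

/-- The curvature `R(X, Y) Z`. -/
def curv (X Y Z : L) : L :=
  ∇ X (∇ Y Z) - ∇ Y (∇ X Z) - ∇ (∇ X Y - ∇ Y X) Z

theorem curv_swap (X Y Z : L) : N.curv Y X Z = -N.curv X Y Z := by
  simp only [curv, N.conn_sub_left]
  abel

theorem bianchi (X Y Z : L) : N.curv X Y Z + N.curv Y Z X + N.curv Z X Y = 0 := by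
  rw [← N.jacobi X Y Z]
  simp only [curv, N.conn_sub_left, N.conn_sub_right]
  abel

/-- The Riemann tensor `g(R(X, Y) Z, W)`. -/
def rm (X Y Z W : L) : C := ⟪N.curv X Y Z, W⟫

theorem rm_swap_left (X Y Z W : L) : N.rm Y X Z W = -N.rm X Y Z W := by
  simp [rm, N.curv_swap X Y]

/-- Metric compatibility turns the commutator of derivatives of the function g(Z, W) into this
skewness. -/
theorem rm_swap_right (X Y Z W : L) : N.rm X Y W Z = -N.rm X Y Z W := by
  have h := N.der_commutator X Y ⟪Z, W⟫
  simp only [N.der_metric, N.der_add] at h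
  simp only [rm, curv, map_sub, LinearMap.sub_apply]
  simp only [N.metric_symm _ Z] at h ⊢
  linear_combination h

theorem rm_bianchi (X Y Z W : L) : N.rm X Y Z W + N.rm Y Z X W + N.rm Z X Y W = 0 := by
  simp only [rm, ← LinearMap.add_apply, ← map_add, N.bianchi, map_zero, LinearMap.zero_apply]

/-- A signed sum of the four Bianchi identities on X, Y, Z, W gives twice the difference of the two
sides. -/
theorem rm_pair_symm [IsAddTorsionFree C] (X Y Z W : L) : N.rm Z W X Y = N.rm X Y Z W := by
  refine nsmul_right_injective two_ne_zero ?_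
  simp only [nsmul_eq_mul, Nat.cast_ofNat]
  have h1 := N.rm_bianchi X Y Z W
  have h2 := N.rm_bianchi Y Z W X
  have h3 := N.rm_bianchi Z W X Y
  have h4 := N.rm_bianchi W X Y Z
  rw [N.rm_swap_right Y Z, N.rm_swap_right Z W, N.rm_swap_left Y W] at h2
  rw [N.rm_swap_left X W, N.rm_swap_right X W, N.rm_swap_left Z X, N.rm_swap_right Z X] at h3
  rw [N.rm_swap_left X W, N.rm_swap_right X Y, N.rm_swap_right Y W] at h4
  linear_combination -h1 - h2 + h3 + h4

end LeviCivitaAlgebra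

end LeviCivitaAlgebra

/-! ### The defect 3-form, the endomorphism h and the Killing field ξ -/

section NearlySasakianAlgebra

/-- A nearly Sasakian structure on a module `L` of vector fields. -/
structure NearlySasakianAlgebra (C L : Type*) [CommRing C] [AddCommGroup L] [Module C L]
    extends LeviCivitaAlgebra C L where
  /-- the `(1,1)`-tensor field of the structure -/
  φ : L →ₗ[C] L
  /-- the characteristic vector field -/
  ξ : L
  φ_sq : ∀ X, φ (φ X) = -X + metric X ξ • ξ
  metric_ξ_ξ : metric ξ ξ = 1
  φ_skew : ∀ X Y, metric (φ X) Y = -metric X (φ Y)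
  nearly : ∀ X, conn X (φ X) - φ (conn X X) = metric X X • ξ - metric X ξ • X

namespace NearlySasakianAlgebra

variable {C L : Type*} [CommRing C] [AddCommGroup L] [Module C L] (N : NearlySasakianAlgebra C L)

local notation "⟪" X ", " Y "⟫" => N.metric X Y
local notation "∇" => N.conn

/-- The defect `(∇_X φ) Y - g(X, Y) ξ + η(Y) X` of the Sasakian condition. -/
def defect : L →ₗ[C] L →ₗ[C] L :=
  LinearMap.mk₂ C (fun X Y => ∇ X (N.φ Y) - N.φ (∇ X Y) - ⟪X, Y⟫ • N.ξ + ⟪Y, N.ξ⟫ • X)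
    (fun X X' Y => by simp [N.conn_add_left, add_smul]; abel)
    (fun f X Y => by simp [N.conn_smul_left, smul_sub, smul_smul, mul_comm])
    (fun X Y Y' => by simp [N.conn_add_right, add_smul]; abel)
    (fun f X Y => by simp [N.conn_smul_right, smul_sub, smul_smul])

theorem conn_φ (X Y : L) :
    ∇ X (N.φ Y) = N.φ (∇ X Y) + N.defect X Y + ⟪X, Y⟫ • N.ξ - ⟪Y, N.ξ⟫ • X := by
  simp only [defect, LinearMap.mk₂_apply]
  abel

theorem defect_self (X : L) : N.defect X X = 0 := by
  simp only [defect, LinearMap.mk₂_apply, N.nearly]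
  abel

theorem defect_swap (X Y : L) : N.defect Y X = -N.defect X Y := by
  have h := N.defect_self (X + Y)
  simp only [map_add, LinearMap.add_apply, N.defect_self, zero_add, add_zero] at h
  exact eq_neg_of_add_eq_zero_left h

theorem metric_φ_right (X Y : L) : ⟪X, N.φ Y⟫ = -⟪N.φ X, Y⟫ := by
  rw [N.φ_skew, neg_neg]

theorem φ_ξ : N.φ N.ξ = 0 := by
  refine N.metric_definite _ ?_
  rw [N.φ_skew, N.φ_sq, N.metric_ξ_ξ]
  simp

theorem metric_φ_ξ (X : L) : ⟪N.φ X, N.ξ⟫ = 0 := by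
  rw [N.φ_skew, N.φ_ξ, map_zero, neg_zero]

theorem φ_φ_φ (X : L) : N.φ (N.φ (N.φ X)) = -N.φ X := by
  rw [N.φ_sq, N.metric_φ_ξ, zero_smul, add_zero]

/-- As φ is skew and ∇ metric, ∇_X φ is skew, and so is Y ↦ g(X, Y)ξ − η(Y)X. Together with
`defect_swap` this makes g(T(·,·),·) totally alternating. -/
theorem metric_defect_swap (X Y Z : L) : ⟪N.defect X Z, Y⟫ = -⟪N.defect X Y, Z⟫ := by
  have h1 := N.der_metric X (N.φ Y) Z
  have h2 := N.der_metric X Y (N.φ Z)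
  rw [N.φ_skew, N.der_neg, h2] at h1
  simp only [N.conn_φ, map_add, map_sub, map_smul, LinearMap.add_apply, LinearMap.sub_apply,
    LinearMap.smul_apply, smul_eq_mul, N.φ_skew] at h1
  simp only [N.metric_symm Y] at h1
  linear_combination -h1 + ⟪X, Y⟫ * N.metric_symm Z N.ξ

theorem metric_conn_ξ_ξ [IsAddTorsionFree C] (X : L) : ⟪∇ X N.ξ, N.ξ⟫ = 0 := by
  have h := N.der_metric X N.ξ N.ξ
  rw [N.metric_ξ_ξ, N.der_one, N.metric_symm N.ξ, ← two_nsmul] at h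
  exact (nsmul_eq_zero_iff_right two_ne_zero).mp h.symm

/-- The endomorphism `X ↦ ∇_X ξ`. -/
def connξ : L →ₗ[C] L where
  toFun X := ∇ X N.ξ
  map_add' X Y := N.conn_add_left X Y N.ξ
  map_smul' f X := N.conn_smul_left f X N.ξ

theorem connξ_apply (X : L) : N.connξ X = ∇ X N.ξ := rfl

/-- The endomorphism `h X = ∇_X ξ + φ X`. -/
def h : L →ₗ[C] L := N.connξ + N.φ

theorem conn_ξ (X : L) : ∇ X N.ξ = N.h X - N.φ X := by
  simp [h, connξ_apply]

/-- The covariant derivative `(∇_X ∇ξ) Y` of the endomorphism `∇ξ`. -/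
def connConnξ (X Y : L) : L := ∇ X (N.h Y - N.φ Y) - (N.h (∇ X Y) - N.φ (∇ X Y))

theorem connConnξ_neg (X Y : L) : N.connConnξ X (-Y) = -N.connConnξ X Y := by
  simp only [connConnξ, N.conn_neg_right, N.conn_sub_right, map_neg]
  abel

theorem connConnξ_neg_left (X Y : L) : N.connConnξ (-X) Y = -N.connConnξ X Y := by
  simp only [connConnξ, N.conn_neg_left, map_neg]
  abel

theorem curv_ξ (X Y : L) : N.curv X Y N.ξ = N.connConnξ X Y - N.connConnξ Y X := by
  simp only [LeviCivitaAlgebra.curv, connConnξ, N.conn_ξ, map_sub]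
  abel

/-- This is the derivative of φ² = −id + ξ ⊗ η. -/
theorem defect_φ (X Y : L) :
    N.defect X (N.φ Y) = -N.φ (N.defect X Y) + ⟪N.h X, Y⟫ • N.ξ + ⟪Y, N.ξ⟫ • N.h X := by
  have h1 := N.conn_φ X (N.φ Y)
  rw [N.φ_sq, N.conn_φ, N.conn_add_right, N.conn_neg_right, N.conn_smul_right, N.der_metric,
    N.metric_φ_ξ] at h1
  simp only [map_add, map_sub, map_smul, N.φ_sq, N.φ_ξ, N.conn_ξ, N.metric_symm Y,
    N.metric_φ_right, LinearMap.sub_apply] at h1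
  rw [N.metric_symm N.ξ Y] at h1
  linear_combination (norm := module) -h1

variable [IsAddTorsionFree C]

/-- Differentiate φξ = 0 and apply φ; ∇_X ξ has no ξ-component because ξ has unit length. -/
theorem h_eq (X : L) : N.h X = -N.φ (N.defect N.ξ X) := by
  have h1 := N.conn_φ X N.ξ
  rw [N.φ_ξ, N.conn_zero_right, N.metric_ξ_ξ, one_smul] at h1
  have h2 := congrArg N.φ h1
  simp only [map_add, map_sub, map_zero, N.φ_sq, N.metric_conn_ξ_ξ, zero_smul, add_zero, map_smul,
    N.φ_ξ, smul_zero] at h2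
  rw [N.defect_swap, map_neg, neg_neg, h, LinearMap.add_apply, connξ_apply]
  rw [eq_comm, sub_eq_zero] at h2
  rw [← h2]
  abel

theorem metric_h_ξ (X : L) : ⟪N.h X, N.ξ⟫ = 0 := by
  rw [h_eq, map_neg, LinearMap.neg_apply, N.metric_φ_ξ, neg_zero]

theorem φ_h (X : L) : N.φ (N.h X) = N.defect N.ξ X := by
  rw [N.h_eq, map_neg, N.φ_sq, N.metric_defect_swap, N.defect_self]
  simp

theorem h_ξ : N.h N.ξ = 0 := by
  rw [N.h_eq, N.defect_self, map_zero, neg_zero]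

/-- Take the first argument of `defect_φ` to be ξ: the correction terms die because hξ = 0. -/
theorem h_φ (X : L) : N.h (N.φ X) = -N.φ (N.h X) := by
  rw [N.h_eq, N.defect_φ, N.h_ξ, ← N.φ_h]
  simp [N.φ_φ_φ]

/-- Alternation of T makes T(ξ, ·) = φh skew, and h anticommutes with φ. As φ is also skew, ∇ξ is
skew, so ξ is Killing. -/
theorem h_skew (X Y : L) : ⟪N.h X, Y⟫ = -⟪X, N.h Y⟫ := by
  rw [N.h_eq, map_neg, LinearMap.neg_apply, N.φ_skew, N.metric_defect_swap, ← N.φ_h, N.h_φ,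
    map_neg, N.φ_sq, N.metric_h_ξ, N.metric_symm X]
  simp

theorem metric_connConnξ_swap (X Y Z : L) :
    ⟪N.connConnξ X Z, Y⟫ = -⟪N.connConnξ X Y, Z⟫ := by
  have h1 := N.der_metric X (N.h Y - N.φ Y) Z
  have h2 := N.der_metric X Y (N.h Z - N.φ Z)
  have h3 : ⟪N.h Y - N.φ Y, Z⟫ = -⟪Y, N.h Z - N.φ Z⟫ := by
    simp only [map_sub, LinearMap.sub_apply, N.h_skew, N.φ_skew]
    ring
  rw [h3, N.der_neg, h2] at h1
  simp only [connConnξ, map_sub, LinearMap.sub_apply, N.h_skew, N.φ_skew] at h1 ⊢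
  simp only [N.metric_symm Y, N.h_skew, N.φ_skew] at h1 ⊢
  linear_combination -h1

/-- Kostant's formula for a Killing field. R(X, Y)ξ is the antisymmetrization of ∇∇ξ, whose values
are skew endomorphisms; Bianchi then recovers ∇∇ξ itself, up to a factor 2. -/
theorem rm_ξ (X Y Z : L) : N.rm X Y N.ξ Z = -⟪N.connConnξ Z X, Y⟫ := by
  refine nsmul_right_injective two_ne_zero ?_
  have h1 := N.rm_bianchi X Y Z N.ξ
  rw [N.rm_swap_right _ _ N.ξ, N.rm_swap_right _ _ N.ξ, N.rm_swap_right _ _ N.ξ] at h1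
  simp only [LeviCivitaAlgebra.rm, N.curv_ξ, map_sub, LinearMap.sub_apply] at h1 ⊢
  simp only [nsmul_eq_mul, Nat.cast_ofNat]
  linear_combination -h1 + N.metric_connConnξ_swap X Y Z - N.metric_connConnξ_swap Y Z X
    + N.metric_connConnξ_swap Z X Y

end NearlySasakianAlgebra

end NearlySasakianAlgebra

/-! ### The Ricci identity for φ and the vanishing of the horizontal part of ∇∇ξ -/

section CurvatureIdentities

namespace NearlySasakianAlgebra

variable {C L : Type*} [CommRing C] [AddCommGroup L] [Module C L] (N : NearlySasakianAlgebra C L)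

local notation "⟪" X ", " Y "⟫" => N.metric X Y
local notation "∇" => N.conn

/-- The covariant derivative `(∇_X T) (Y, Z)` of the defect `T`. -/
def connDefect (X Y Z : L) : L :=
  ∇ X (N.defect Y Z) - N.defect (∇ X Y) Z - N.defect Y (∇ X Z)

theorem connDefect_swap (X Y Z : L) : N.connDefect X Z Y = -N.connDefect X Y Z := by
  simp only [connDefect, N.defect_swap _ Y, N.defect_swap _ (∇ X Y), N.conn_neg_right]
  abel

theorem metric_connDefect_swap (X Y Z W : L) :
    ⟪N.connDefect X Y W, Z⟫ = -⟪N.connDefect X Y Z, W⟫ := by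
  have h1 := N.der_metric X (N.defect Y W) Z
  have h2 := N.der_metric X (N.defect Y Z) W
  rw [N.metric_defect_swap Y Z W, N.der_neg, h2] at h1
  simp only [connDefect, map_sub, LinearMap.sub_apply]
  have e1 := N.metric_defect_swap (∇ X Y) Z W
  have e2 := N.metric_defect_swap Y Z (∇ X W)
  have e3 := N.metric_defect_swap Y W (∇ X Z)
  linear_combination -h1 - e1 - e2 - e3

/-- The Ricci identity for φ: writing ∇φ as T plus its Sasakian value, the second derivatives
contribute ∇T and terms in ∇ξ. -/
theorem curv_φ (X Y Z : L) :
    N.curv X Y (N.φ Z) = N.φ (N.curv X Y Z) + N.connDefect X Y Z - N.connDefect Y X Z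
      + ⟪Y, Z⟫ • ∇ X N.ξ - ⟪∇ X N.ξ, Z⟫ • Y - ⟪X, Z⟫ • ∇ Y N.ξ + ⟪∇ Y N.ξ, Z⟫ • X := by
  simp only [LeviCivitaAlgebra.curv, connDefect, N.conn_φ, N.conn_add_right, N.conn_sub_right,
    N.conn_smul_right, N.der_metric, map_sub, LinearMap.sub_apply, N.metric_symm Z,
    N.metric_symm _ (∇ X Z), N.metric_symm _ (∇ Y Z)]
  module

/-- The action of `φ` on the last two slots of the Riemann tensor. -/
def φrm (X Y Z W : L) : C := N.rm X Y (N.φ Z) W + N.rm X Y Z (N.φ W)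

theorem φrm_eq (X Y Z W : L) :
    N.φrm X Y Z W = ⟪N.connDefect X Y Z, W⟫ - ⟪N.connDefect Y X Z, W⟫
      + (⟪Y, Z⟫ * ⟪∇ X N.ξ, W⟫ - ⟪∇ X N.ξ, Z⟫ * ⟪Y, W⟫
        - ⟪X, Z⟫ * ⟪∇ Y N.ξ, W⟫ + ⟪∇ Y N.ξ, Z⟫ * ⟪X, W⟫) := by
  simp only [φrm, LeviCivitaAlgebra.rm, N.curv_φ, map_add, map_sub, map_smul, LinearMap.add_apply,
    LinearMap.sub_apply, LinearMap.smul_apply, smul_eq_mul, N.φ_skew]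
  ring

/-- The twelve terms regroup into four Bianchi sums, one for each variable that carries φ. -/
theorem φrm_alternation (X Y Z W : L) :
    N.φrm X Y Z W + N.φrm Y Z X W + N.φrm Z X Y W
      + N.φrm Z W X Y + N.φrm X W Y Z + N.φrm Y W Z X = 0 := by
  have h1 := N.rm_bianchi X Y Z (N.φ W)
  have h2 := N.rm_bianchi X Y W (N.φ Z)
  have h3 := N.rm_bianchi X Z W (N.φ Y)
  have h4 := N.rm_bianchi Y Z W (N.φ X)
  have e := fun A B D => N.rm_swap_left A B D (N.φ X)
  have hs := N.rm_swap_right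
  rw [N.rm_swap_left X W] at h2
  rw [N.rm_swap_left Z X, N.rm_swap_left X W] at h3
  rw [N.rm_swap_left Y W] at h4
  simp only [φrm, hs _ _ W (N.φ _), hs _ _ X (N.φ _), hs _ _ Y (N.φ _), hs _ _ Z (N.φ _)]
  linear_combination h1 - h2 + h3 - h4

variable [IsAddTorsionFree C]

theorem metric_conn_ξ_swap (X Y : L) : ⟪∇ Y N.ξ, X⟫ = -⟪∇ X N.ξ, Y⟫ := by
  simp only [N.conn_ξ, map_sub, LinearMap.sub_apply]
  rw [N.h_skew, N.φ_skew, N.metric_symm Y, N.metric_symm Y]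
  ring

/-- The three-form `g(T(·, ·), ·)` is closed. -/
theorem defect_closed (X Y Z W : L) :
    ⟪N.connDefect X Y Z, W⟫ - ⟪N.connDefect Y X Z, W⟫
      + ⟪N.connDefect Z X Y, W⟫ - ⟪N.connDefect W X Y, Z⟫ = 0 := by
  -- Among the twelve ∇T terms of the alternated Ricci identity each of the four below occurs three
  -- times, and the ∇ξ terms cancel.
  refine nsmul_right_injective three_ne_zero ?_
  have h := N.φrm_alternation X Y Z W
  have p := fun A B D F => congrArg (fun V => ⟪V, F⟫) (N.connDefect_swap A B D)
  simp only [map_neg, LinearMap.neg_apply] at p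
  have m := N.metric_connDefect_swap
  simp only [φrm_eq, p Y X Z, p Z X Y, p X Y Z, p Z X W, p W X Z, p X Y W, p Y Z W, m Z X Y W,
    m W X Y Z, m X Y Z W, m Y Z X W, m W Y X Z, p W X Y, N.metric_symm Y X, N.metric_symm Z X,
    N.metric_symm W X, N.metric_symm Z Y, N.metric_symm W Y, N.metric_symm W Z,
    N.metric_conn_ξ_swap X Y, N.metric_conn_ξ_swap X Z, N.metric_conn_ξ_swap X W,
    N.metric_conn_ξ_swap Y Z, N.metric_conn_ξ_swap Y W, N.metric_conn_ξ_swap Z W] at h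
  simp only [nsmul_eq_mul, Nat.cast_ofNat, mul_zero]
  linear_combination h

/-- By pair symmetry the left side is the derivation φ applied to the Riemann tensor. In the Ricci
identity its ∇T terms form the exterior derivative of the 3-form, and the ∇ξ terms cancel because ∇ξ
is skew. -/
theorem φrm_add_φrm (X Y Z W : L) : N.φrm X Y Z W + N.φrm Z W X Y = 0 := by
  have h := N.defect_closed X Y Z W
  have p := fun A B D F => congrArg (fun V => ⟪V, F⟫) (N.connDefect_swap A B D)
  simp only [map_neg, LinearMap.neg_apply] at p
  simp only [φrm_eq, p Z X W, p W X Z, N.metric_connDefect_swap Z X Y W,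
    N.metric_connDefect_swap W X Y Z, N.metric_symm Z X,
    N.metric_symm W X, N.metric_symm Z Y, N.metric_symm W Y,
    N.metric_conn_ξ_swap X Z, N.metric_conn_ξ_swap X W,
    N.metric_conn_ξ_swap Y Z, N.metric_conn_ξ_swap Y W]
  linear_combination h

/-- The case Z = ξ of the previous identity, read through Kostant's formula: the derivation φ
annihilates the trilinear form of ∇∇ξ. -/
theorem metric_connConnξ_φ (X Y W : L) :
    ⟪N.connConnξ W (N.φ X), Y⟫ + ⟪N.connConnξ W X, N.φ Y⟫ + ⟪N.connConnξ (N.φ W) X, Y⟫ = 0 := by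
  have h := N.φrm_add_φrm X Y N.ξ W
  simp only [φrm, N.φ_ξ] at h
  rw [N.rm_pair_symm _ _ N.ξ, N.rm_pair_symm _ _ N.ξ] at h
  simp only [N.rm_ξ] at h
  simp only [LeviCivitaAlgebra.rm, LeviCivitaAlgebra.curv, N.conn_zero_right] at h
  simp at h
  linear_combination -h

/-- The horizontal part of `∇∇ξ` vanishes. -/
theorem metric_connConnξ_φ_φ_φ (X Y Z : L) :
    ⟪N.connConnξ (N.φ X) (N.φ Y), N.φ Z⟫ = 0 := by
  -- On horizontal arguments φ acts in the three slots by commuting J₁, J₂, J₃ with Jᵢ² = −1, and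
  -- here their sum is 0. Then J₃² = (J₁ + J₂)² gives 2J₁J₂ = 1, hence J₁ = −2J₂ and J₂ = −2J₁, so
  -- 3J₂ = 0.
  have key : ∀ X Y Z, ⟪N.connConnξ (N.φ X) (N.φ (N.φ Y)), N.φ Z⟫
      + ⟪N.connConnξ (N.φ X) (N.φ Y), N.φ (N.φ Z)⟫
      + ⟪N.connConnξ (N.φ (N.φ X)) (N.φ Y), N.φ Z⟫ = 0 :=
    fun X Y Z => N.metric_connConnξ_φ (N.φ Y) (N.φ Z) (N.φ X)
  have two : ∀ X Y Z, 2 * ⟪N.connConnξ (N.φ (N.φ X)) (N.φ (N.φ Y)), N.φ Z⟫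
      = ⟪N.connConnξ (N.φ X) (N.φ Y), N.φ Z⟫ := by
    intro X Y Z
    have h1 := key (N.φ X) Y Z
    have h2 := key X (N.φ Y) Z
    have h3 := key X Y (N.φ Z)
    simp only [N.φ_φ_φ, connConnξ_neg, connConnξ_neg_left, map_neg, LinearMap.neg_apply]
      at h1 h2 h3
    linear_combination h1 + h2 - h3
  have zero : ∀ X Y Z, ⟪N.connConnξ (N.φ X) (N.φ (N.φ Y)), N.φ Z⟫ = 0 := by
    intro X Y Z
    have h1 := two (N.φ X) Y Z
    have h2 := two X (N.φ Y) Z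
    simp only [N.φ_φ_φ, connConnξ_neg, connConnξ_neg_left, map_neg, LinearMap.neg_apply]
      at h1 h2
    refine (nsmul_eq_zero_iff_right three_ne_zero).mp ?_
    rw [nsmul_eq_mul, Nat.cast_ofNat]
    linear_combination h2 - 2 * h1
  have h := zero X (N.φ Y) Z
  rwa [N.φ_φ_φ, connConnξ_neg, map_neg, LinearMap.neg_apply, neg_eq_zero] at h

end NearlySasakianAlgebra

end CurvatureIdentities

/-! ### Vanishing of the horizontal defect, and the wedge identity for the rest -/

section HorizontalDefect

namespace NearlySasakianAlgebra

variable {C L : Type*} [CommRing C] [AddCommGroup L] [Module C L] (N : NearlySasakianAlgebra C L)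
  [IsAddTorsionFree C]

local notation "⟪" X ", " Y "⟫" => N.metric X Y
local notation "∇" => N.conn

variable {X Y Z W U : L}

omit [IsAddTorsionFree C] in
theorem φ_neg_φ (hX : ⟪X, N.ξ⟫ = 0) : N.φ (-N.φ X) = X := by
  rw [map_neg, N.φ_sq, hX, zero_smul, add_zero, neg_neg]

/-- Horizontal fields are φ-images, so ∇∇ξ = ∇h − ∇φ vanishes on them, and ∇φ is T there up to
multiples of ξ. -/
theorem conn_h (hX : ⟪X, N.ξ⟫ = 0) (hY : ⟪Y, N.ξ⟫ = 0) (hZ : ⟪Z, N.ξ⟫ = 0) :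
    ⟪∇ X (N.h Y), Z⟫ = ⟪N.h (∇ X Y), Z⟫ + ⟪N.defect X Y, Z⟫ := by
  have h := N.metric_connConnξ_φ_φ_φ (-N.φ X) (-N.φ Y) (-N.φ Z)
  rw [N.φ_neg_φ hX, N.φ_neg_φ hY, N.φ_neg_φ hZ, connConnξ, N.conn_sub_right, N.conn_φ] at h
  simp only [map_add, map_sub, map_smul, LinearMap.add_apply, LinearMap.sub_apply,
    LinearMap.smul_apply, hY, N.metric_symm N.ξ, hZ, smul_eq_mul] at h
  linear_combination h

omit [IsAddTorsionFree C] in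
theorem metric_defect_φ (hY : ⟪Y, N.ξ⟫ = 0) (hZ : ⟪Z, N.ξ⟫ = 0) :
    ⟪N.defect X (N.φ Y), Z⟫ = ⟪N.defect X Y, N.φ Z⟫ := by
  rw [N.defect_φ, N.metric_φ_right]
  simp [hY, N.metric_symm N.ξ, hZ]

/-- Differentiate hφ = −φh, replacing ∇h and ∇φ by T. -/
theorem metric_defect_h (hX : ⟪X, N.ξ⟫ = 0) (hY : ⟪Y, N.ξ⟫ = 0) (hZ : ⟪Z, N.ξ⟫ = 0) :
    ⟪N.defect X (N.h Y), Z⟫ = ⟪N.defect X Y, N.h Z⟫ := by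
  have h1 := N.conn_h hX (N.metric_φ_ξ Y) hZ
  have h2 := N.conn_h hX hY (N.metric_φ_ξ Z)
  rw [N.h_φ, N.conn_neg_right, N.conn_φ, N.conn_φ, N.metric_defect_φ hY hZ] at h1
  simp only [map_add, map_sub, map_neg, map_smul, LinearMap.add_apply, LinearMap.sub_apply,
    LinearMap.neg_apply, LinearMap.smul_apply, hY, N.metric_symm N.ξ, hZ, smul_eq_mul, N.h_skew,
    N.φ_skew, N.h_ξ, map_zero,
    LinearMap.zero_apply, N.h_φ] at h1 h2
  linear_combination -h1 + h2

theorem metric_defect_φ_h (hX : ⟪X, N.ξ⟫ = 0) (hY : ⟪Y, N.ξ⟫ = 0) (hZ : ⟪Z, N.ξ⟫ = 0) :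
    ⟪N.defect X (N.φ (N.h Y)), Z⟫ = -⟪N.defect X Y, N.φ (N.h Z)⟫ := by
  rw [N.metric_defect_φ (N.metric_h_ξ Y) hZ, N.metric_defect_h hX hY (N.metric_φ_ξ Z), N.h_φ,
    map_neg]

/-- Moving φh from one slot of the 3-form to another costs a sign. Carrying it once around the three
slots costs three signs, so the value is its own negative. Replacing Z by φZ turns φh into h. -/
theorem metric_defect_h_eq_zero (hX : ⟪X, N.ξ⟫ = 0) (hY : ⟪Y, N.ξ⟫ = 0) (Z : L) :
    ⟪N.defect X Y, N.h Z⟫ = 0 := by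
  suffices H : ∀ {Z}, ⟪Z, N.ξ⟫ = 0 → ⟪N.defect X Y, N.φ (N.h Z)⟫ = 0 by
    have h := H (N.metric_φ_ξ Z)
    rwa [N.h_φ, map_neg, N.φ_sq, N.metric_h_ξ, zero_smul, add_zero, neg_neg] at h
  intro Z hZ
  refine (nsmul_eq_zero_iff_right two_ne_zero).mp ?_
  have h1 := N.metric_defect_φ_h hX hY hZ
  have h2 := N.metric_defect_φ_h hY hX hZ
  have h3 := N.metric_defect_φ_h hZ hY hX
  have e1 := N.metric_defect_swap Y Z (N.φ (N.h X))
  have e2 := N.metric_defect_swap Z X (N.φ (N.h Y))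
  have e3 := N.metric_defect_swap X Z (N.φ (N.h Y))
  rw [N.defect_swap X Y] at h2
  rw [N.defect_swap Y Z] at h3
  rw [N.defect_swap X Z] at e2
  simp only [map_neg, LinearMap.neg_apply] at h2 h3 e2
  rw [nsmul_eq_mul, Nat.cast_ofNat]
  linear_combination h1 - h2 + h3 + e1 - e2 - e3

/-- The component of `T(X, Y)` orthogonal to `ξ`, where `T` is the defect. -/
def horDefect (X Y : L) : L := N.defect X Y - ⟪N.defect X Y, N.ξ⟫ • N.ξ

omit [IsAddTorsionFree C] in
theorem metric_horDefect (hZ : ⟪Z, N.ξ⟫ = 0) :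
    ⟪N.horDefect X Y, Z⟫ = ⟪N.defect X Y, Z⟫ := by
  simp [horDefect, N.metric_symm N.ξ, hZ]

omit [IsAddTorsionFree C] in
theorem metric_horDefect_ξ (X Y : L) : ⟪N.horDefect X Y, N.ξ⟫ = 0 := by
  simp [horDefect, N.metric_ξ_ξ]

omit [IsAddTorsionFree C] in
theorem metric_horDefect_self (X Y : L) :
    ⟪N.horDefect X Y, N.horDefect X Y⟫ = ⟪N.defect X Y, N.horDefect X Y⟫ :=
  N.metric_horDefect (N.metric_horDefect_ξ X Y)

theorem h_horDefect (hX : ⟪X, N.ξ⟫ = 0) (hY : ⟪Y, N.ξ⟫ = 0) : N.h (N.horDefect X Y) = 0 := by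
  refine N.ext_metric fun Z => ?_
  rw [N.h_skew, N.metric_horDefect (N.metric_h_ξ Z), N.metric_defect_h_eq_zero hX hY]
  simp

theorem horDefect_eq_zero (hX : ⟪X, N.ξ⟫ = 0) (hY : ⟪Y, N.ξ⟫ = 0) : N.horDefect X Y = 0 := by
  have hV := N.metric_horDefect_ξ X Y
  have hhV := N.h_horDefect hX hY
  -- For V the horizontal part of T(X, Y), hV = 0, so `conn_h` gives T(Y, V) = −h(∇_Y V)
  -- horizontally. Pairing with the horizontal part of T(Y, V), which h also kills, gives norm zero.
  -- Then |V|² = g(T(X, Y), V) = −g(T(Y, V), X) up to the order of X and Y, which vanishes.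
  have h1 : N.horDefect Y (N.horDefect X Y) = 0 := by
    refine N.metric_definite _ ?_
    rw [N.metric_horDefect_self]
    have h := N.conn_h hY hV (N.metric_horDefect_ξ Y (N.horDefect X Y))
    rw [hhV, N.conn_zero_right, N.h_skew, N.h_horDefect hY hV] at h
    simpa using h.symm
  refine N.metric_definite _ ?_
  have h2 := N.metric_horDefect (X := Y) (Y := N.horDefect X Y) hX
  rw [h1, N.metric_defect_swap, N.defect_swap X Y] at h2
  rw [N.metric_horDefect_self]
  simpa using h2.symm

theorem metric_defect_eq_zero (hX : ⟪X, N.ξ⟫ = 0) (hY : ⟪Y, N.ξ⟫ = 0) (hZ : ⟪Z, N.ξ⟫ = 0) :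
    ⟪N.defect X Y, Z⟫ = 0 := by
  rw [← N.metric_horDefect hZ, N.horDefect_eq_zero hX hY, map_zero, LinearMap.zero_apply]

omit [IsAddTorsionFree C] in
theorem metric_defect_ξ (X Y : L) : ⟪N.defect X Y, N.ξ⟫ = ⟪N.defect N.ξ X, Y⟫ := by
  rw [N.metric_defect_swap, N.defect_swap N.ξ, map_neg, LinearMap.neg_apply, neg_neg]

/-- With no horizontal part left, T(X, Y) is a multiple of ξ, and alternation reads off the
coefficient from T(ξ, ·) = φh. -/
theorem metric_defect_of_horizontal (hX : ⟪X, N.ξ⟫ = 0) (hY : ⟪Y, N.ξ⟫ = 0) (Z : L) :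
    ⟪N.defect X Y, Z⟫ = ⟪Z, N.ξ⟫ * ⟪N.φ (N.h X), Y⟫ := by
  have h := N.metric_defect_eq_zero hX hY (Z := Z - ⟪Z, N.ξ⟫ • N.ξ) (by simp [N.metric_ξ_ξ])
  rw [map_sub, map_smul, N.metric_defect_ξ, ← N.φ_h, smul_eq_mul] at h
  exact sub_eq_zero.mp h

theorem metric_φ_h_swap (X Y : L) : ⟪N.φ (N.h Y), X⟫ = -⟪N.φ (N.h X), Y⟫ := by
  rw [N.φ_h, N.φ_h, N.metric_defect_swap]

/-- The horizontal values of the 3-form are identically zero, so its derivative sees only the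
ξ-components of ∇_X Y, ∇_X Z and ∇_X W; for horizontal V that of ∇_X V is −g(∇_X ξ, V). -/
theorem metric_connDefect (X : L) (hY : ⟪Y, N.ξ⟫ = 0) (hZ : ⟪Z, N.ξ⟫ = 0)
    (hW : ⟪W, N.ξ⟫ = 0) :
    ⟪N.connDefect X Y Z, W⟫ = ⟪∇ X N.ξ, W⟫ * ⟪N.φ (N.h Y), Z⟫
      + ⟪∇ X N.ξ, Y⟫ * ⟪N.φ (N.h Z), W⟫ - ⟪∇ X N.ξ, Z⟫ * ⟪N.φ (N.h Y), W⟫ := by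
  have hη : ∀ {V}, ⟪V, N.ξ⟫ = 0 → ⟪∇ X V, N.ξ⟫ = -⟪∇ X N.ξ, V⟫ := by
    intro V hV
    have h := N.der_metric X V N.ξ
    rw [hV, N.der_zero, N.metric_symm V] at h
    linear_combination -h
  have h := N.der_metric X (N.defect Y Z) W
  rw [N.metric_defect_eq_zero hY hZ hW, N.der_zero, N.metric_defect_of_horizontal hY hZ, hη hW] at h
  simp only [connDefect, map_sub, LinearMap.sub_apply]
  have e1 := N.metric_defect_of_horizontal hZ hW (∇ X Y)
  have e2 := N.metric_defect_of_horizontal hY hW (∇ X Z)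
  rw [N.metric_defect_swap, N.defect_swap (∇ X Y), hη hY] at e1
  rw [N.metric_defect_swap, hη hZ] at e2
  simp only [map_neg, LinearMap.neg_apply] at e1
  linear_combination -h - e1 + e2

/-- The wedge product of the two-forms `g(∇ξ ·, ·)` and `g(φ h ·, ·)` vanishes on the horizontal
distribution. -/
theorem wedge_eq_zero (hX : ⟪X, N.ξ⟫ = 0) (hY : ⟪Y, N.ξ⟫ = 0) (hZ : ⟪Z, N.ξ⟫ = 0)
    (hW : ⟪W, N.ξ⟫ = 0) :
    ⟪∇ X N.ξ, Y⟫ * ⟪N.φ (N.h Z), W⟫ + ⟪∇ X N.ξ, W⟫ * ⟪N.φ (N.h Y), Z⟫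
      - ⟪∇ X N.ξ, Z⟫ * ⟪N.φ (N.h Y), W⟫ - ⟪∇ Y N.ξ, W⟫ * ⟪N.φ (N.h X), Z⟫
      + ⟪∇ Y N.ξ, Z⟫ * ⟪N.φ (N.h X), W⟫ + ⟪∇ Z N.ξ, W⟫ * ⟪N.φ (N.h X), Y⟫ = 0 := by
  -- Expanded by `metric_connDefect`, closedness contains each product of the wedge twice.
  refine (nsmul_eq_zero_iff_right two_ne_zero).mp ?_
  have h := N.defect_closed X Y Z W
  rw [N.metric_connDefect X hY hZ hW, N.metric_connDefect Y hX hZ hW,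
    N.metric_connDefect Z hX hY hW, N.metric_connDefect W hX hY hZ,
    N.metric_conn_ξ_swap X Y, N.metric_conn_ξ_swap X Z, N.metric_conn_ξ_swap X W,
    N.metric_conn_ξ_swap Y Z, N.metric_conn_ξ_swap Y W, N.metric_conn_ξ_swap Z W] at h
  rw [nsmul_eq_mul, Nat.cast_ofNat]
  linear_combination h

/-- At a point `ev` where a horizontal field `U` is orthogonal to `Z`, `φ Z`, `h Z` and `φ h Z`,
one of `U` and `φ h Z` vanishes. -/
theorem mul_eq_zero_of_orthogonal {R : Type*} [CommRing R] (ev : C →+* R) (hU : ⟪U, N.ξ⟫ = 0)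
    (hZ : ⟪Z, N.ξ⟫ = 0) (h1 : ev ⟪U, Z⟫ = 0) (h2 : ev ⟪U, N.φ Z⟫ = 0)
    (h3 : ev ⟪U, N.h Z⟫ = 0) (h4 : ev ⟪U, N.φ (N.h Z)⟫ = 0) :
    ev ⟪U, U⟫ * ev ⟪N.φ (N.h Z), N.φ (N.h Z)⟫ = 0 := by
  -- On (U, φU, Z, φhZ) the first product is −|U|²|φhZ|²; every other one has a factor that is zero
  -- or becomes zero at the point by orthogonality.
  have hw := N.wedge_eq_zero hU (N.metric_φ_ξ U) hZ (N.metric_φ_ξ (N.h Z))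
  have hhU : ⟪N.h U, N.φ U⟫ = 0 := by
    refine (nsmul_eq_zero_iff_right two_ne_zero).mp ?_
    have h := N.metric_φ_h_swap U U
    rw [N.φ_skew] at h
    rw [nsmul_eq_mul, Nat.cast_ofNat]
    linear_combination -h
  have e1 : ⟪∇ U N.ξ, N.φ U⟫ = -⟪U, U⟫ := by
    rw [N.conn_ξ, map_sub, LinearMap.sub_apply, hhU, N.φ_skew, N.φ_sq, hU]
    simp
  have e2 : ⟪N.φ (N.h (N.φ U)), Z⟫ = -⟪U, N.h Z⟫ := by
    rw [N.h_φ, map_neg, N.φ_sq, N.metric_h_ξ, ← N.h_skew]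
    simp
  have e3 : ⟪∇ U N.ξ, Z⟫ = ⟪U, N.φ Z⟫ - ⟪U, N.h Z⟫ := by
    rw [N.conn_ξ, map_sub, LinearMap.sub_apply, N.h_skew, N.φ_skew]
    ring
  have e4 : ⟪N.φ (N.h U), Z⟫ = -⟪U, N.φ (N.h Z)⟫ := by
    rw [N.metric_φ_h_swap Z U, N.metric_symm]
  have e5 : ⟪∇ (N.φ U) N.ξ, Z⟫ = ⟪U, N.φ (N.h Z)⟫ + ⟪U, Z⟫ := by
    rw [N.conn_ξ, map_sub, LinearMap.sub_apply, N.h_φ, map_neg, LinearMap.neg_apply, e4, N.φ_sq, hU]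
    simp
  have e6 : ⟪N.φ (N.h U), N.φ U⟫ = 0 := by
    refine (nsmul_eq_zero_iff_right two_ne_zero).mp ?_
    have h := N.h_skew U U
    rw [N.φ_skew, N.φ_sq, hU, nsmul_eq_mul, Nat.cast_ofNat]
    rw [N.metric_symm U] at h
    simp only [zero_smul, add_zero, map_neg]
    linear_combination h
  rw [e1, e2, e3, e4, e5, e6] at hw
  have h := congrArg ev hw
  simp only [map_add, map_sub, map_mul, map_neg, h1, h2, h3, h4, map_zero] at h
  linear_combination -h

/-- If `φ h` vanishes, then so does the defect. -/
theorem defect_eq_zero (hh : ∀ X, N.φ (N.h X) = 0) (X Y : L) : N.defect X Y = 0 := by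
  have hξ : ∀ X, N.defect N.ξ X = 0 := fun X => by rw [← N.φ_h, hh]
  have key : ∀ {X Y}, ⟪X, N.ξ⟫ = 0 → ⟪Y, N.ξ⟫ = 0 → N.defect X Y = 0 := by
    intro X Y hX hY
    refine N.ext_metric fun Z => ?_
    rw [N.metric_defect_of_horizontal hX hY, hh]
    simp
  have h := key (X := X - ⟪X, N.ξ⟫ • N.ξ) (Y := Y - ⟪Y, N.ξ⟫ • N.ξ) (by simp [N.metric_ξ_ξ])
    (by simp [N.metric_ξ_ξ])
  have hξ' : ∀ X, N.defect X N.ξ = 0 := fun X => by rw [N.defect_swap, hξ, neg_zero]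
  simpa [hξ, hξ'] using h

end NearlySasakianAlgebra

end HorizontalDefect

/-! ### Smooth vector fields: extension, brackets as derivations, smoothness of ∇ -/

section SmoothFields

variable {E : Type*} [NormedAddCommGroup E] [NormedSpace ℝ E]
  {H : Type*} [TopologicalSpace H] {I : ModelWithCorners ℝ E H}
  {M : Type*} [TopologicalSpace M] [ChartedSpace H M] [IsManifold I ∞ M]

theorem isManifold_minSmoothness (k : ℕ) : IsManifold I (minSmoothness ℝ k) M := by
  rw [minSmoothness_of_isRCLikeNormedField]
  infer_instance

theorem contMDiffAt_mvfderiv_apply {f : M → ℝ} {X : Π x : M, TangentSpace I x} {x : M}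
    (hf : CMDiffAt ∞ f x) (hX : CMDiffAt ∞ (T% X) x) :
    CMDiffAt ∞ (fun y => d% f y (X y)) x := by
  have h1 : CMDiffAt ∞ (inTangentCoordinates I 𝓘(ℝ, ℝ) id f (mfderiv% f) x) x :=
    hf.mfderiv_const le_rfl
  have h2 : CMDiffAt ∞ (fun y => (⟨f y, mfderiv% f y (X y)⟩ : TangentBundle 𝓘(ℝ, ℝ) ℝ)) x :=
    ContMDiffAt.clm_apply_of_inCoordinates (E₁ := fun x : M => TangentSpace I x)
      (E₂ := fun x : ℝ => TangentSpace 𝓘(ℝ, ℝ) x) (b₁ := fun x => x) (b₂ := f) h1 hX hf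
  exact ((contMDiff_snd_tangentBundle_modelSpace ℝ 𝓘(ℝ, ℝ)).contMDiffAt).comp x h2

theorem exists_contMDiff_extend [FiniteDimensional ℝ E] [T2Space M] {x : M}
    (v : TangentSpace I x) :
    ∃ X : Π x : M, TangentSpace I x, CMDiff ∞ (T% X) ∧ X x = v := by
  obtain ⟨s, hs, hX⟩ := exists_contMDiffOn_extend (k := ∞) I E v
  obtain ⟨u, hus, hu, hxu⟩ := mem_nhds_iff.mp hs
  obtain ⟨f, -, hf⟩ := (SmoothBumpFunction.nhds_basis_tsupport (I := I) x).mem_iff.mp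
    (hu.mem_nhds hxu)
  refine ⟨(f : M → ℝ) • extend E v, ?_, ?_⟩
  · exact ContMDiffOn.smul_section_of_tsupport f.contMDiff.contMDiffOn hu hf (hX.mono hus)
  · simp

variable [FiniteDimensional ℝ E]

/-- The Lie bracket of vector fields acts on functions as the commutator of derivations. -/
theorem mvfderiv_mlieBracket [T2Space M] {X Y : Π x : M, TangentSpace I x} {f : M → ℝ}
    (hX : CMDiff ∞ (T% X)) (hY : CMDiff ∞ (T% Y)) (hf : CMDiff ∞ f) (x : M) :
    d% (fun y => d% f y (Y y)) x (X x) - d% (fun y => d% f y (X y)) x (Y x)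
      = d% f x (mlieBracket I X Y x) := by
  have : CompleteSpace E := FiniteDimensional.complete ℝ E
  rcases subsingleton_or_nontrivial E with hE | hE
  · have : Subsingleton (TangentSpace I x) := hE
    rw [Subsingleton.elim (X x) 0, Subsingleton.elim (Y x) 0,
      Subsingleton.elim (mlieBracket I X Y x) 0]
    simp
  obtain ⟨v, hv⟩ : ∃ v : TangentSpace I x, v ≠ 0 := exists_ne (0 : E)
  obtain ⟨Z, hZ, rfl⟩ := exists_contMDiff_extend v
  have := isManifold_minSmoothness (I := I) (M := M) 2
  have := isManifold_minSmoothness (I := I) (M := M) 3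
  have : IsManifold I (∞ + 1) M := inferInstanceAs (IsManifold I ∞ M)
  have h2 : minSmoothness ℝ 2 ≤ (∞ : ℕ∞ω) := by
    rw [minSmoothness_of_isRCLikeNormedField]
    exact ENat.LEInfty.out
  have hs : ∀ {V W : Π x : M, TangentSpace I x}, CMDiff ∞ (T% V) → CMDiff ∞ (T% W) →
      CMDiff ∞ (T% (mlieBracket I V W)) := fun hV hW =>
    ContDiff.mlieBracket_vectorField (m := ⊤) (n := ⊤) hV hW (by simp)
  have hd : ∀ {V : Π x : M, TangentSpace I x}, CMDiff ∞ (T% V) → ∀ y, MDiffAt (T% V) y :=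
    fun hV y => hV.mdifferentiableAt (by simp)
  have hder : ∀ {V : Π x : M, TangentSpace I x} {g : M → ℝ}, CMDiff ∞ (T% V) → CMDiff ∞ g →
      CMDiff ∞ (fun y => d% g y (V y)) := fun hV hg y =>
    contMDiffAt_mvfderiv_apply (hg y) (hV y)
  have hdf : ∀ {g : M → ℝ}, CMDiff ∞ g → ∀ y, MDiffAt g y :=
    fun hg y => hg.mdifferentiableAt (by simp)
  have hsmul : ∀ {V W : Π x : M, TangentSpace I x} {g : M → ℝ}, CMDiff ∞ (T% W) → CMDiff ∞ g →
      mlieBracket I V (g • W) = (fun y => d% g y (V y)) • W + g • mlieBracket I V W := by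
    intro V W g hW hg
    funext y
    exact mlieBracket_smul_right (hdf hg y) (hd hW y)
  have h1 : ∀ {V W : Π x : M, TangentSpace I x}, CMDiff ∞ (T% V) → CMDiff ∞ (T% W) →
      mlieBracket I V (mlieBracket I W (f • Z)) x
        = d% (fun y => d% f y (W y)) x (V x) • Z x + d% f x (W x) • mlieBracket I V Z x
          + (d% f x (V x) • mlieBracket I W Z x + f x • mlieBracket I V (mlieBracket I W Z) x) := by
    intro V W hV hW
    rw [hsmul hZ hf, mlieBracket_add_right (hd ((hder hW hf).smul_section hZ) x)
      (hd (hf.smul_section (hs hW hZ)) x), hsmul hZ (hder hW hf), hsmul (hs hW hZ) hf]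
    rfl
  -- Comparing the Jacobi identity for X, Y, fZ with f times the one for X, Y, Z leaves the
  -- commutator identity as the coefficient of Z, which is nonzero at the point.
  have hJ := leibniz_identity_mlieBracket_apply (I := I) (U := X) (V := Y) (W := f • Z) (x := x)
    ((hX x).of_le h2) ((hY x).of_le h2) (((hf.smul_section hZ) x).of_le h2)
  have hJ' := leibniz_identity_mlieBracket_apply (I := I) (U := X) (V := Y) (W := Z) (x := x)
    ((hX x).of_le h2) ((hY x).of_le h2) ((hZ x).of_le h2)
  rw [h1 hX hY, h1 hY hX, hsmul hZ hf, hJ'] at hJ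
  simp only [Pi.add_apply, Pi.smul_apply', smul_add] at hJ
  have key : (d% (fun y => d% f y (Y y)) x (X x) - d% (fun y => d% f y (X y)) x (Y x)
      - d% f x (mlieBracket I X Y x)) • Z x = 0 := by
    rw [← sub_eq_zero] at hJ
    rw [← hJ]
    module
  exact sub_eq_zero.mp ((smul_eq_zero.mp key).resolve_right hv)

variable [RiemannianBundle (fun x : M => TangentSpace I x)]
  [IsContMDiffRiemannianBundle I ∞ E (fun x : M => TangentSpace I x)]

/-- A vector field is smooth if so are its inner products with smooth fields. -/
theorem contMDiffAt_of_inner {W : Π x : M, TangentSpace I x} {x : M}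
    (h : ∀ Z : Π x : M, TangentSpace I x, (∀ᶠ y in nhds x, CMDiffAt ∞ (T% Z) y) →
      CMDiffAt ∞ (fun y => inner ℝ (Z y) (W y)) x) : CMDiffAt ∞ (T% W) x := by
  let e := trivializationAt E (TangentSpace I : M → Type _) x
  have hx : x ∈ e.baseSet := mem_baseSet_trivializationAt' x
  let b := Module.finBasis ℝ E
  -- The frame coefficients of W solve the linear system with the Gram matrix of a local frame and
  -- right side the products of W with the frame; Cramer's rule makes them smooth.
  let G : M → Matrix (Fin (Module.finrank ℝ E)) (Fin (Module.finrank ℝ E)) ℝ := fun y =>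
    Matrix.of fun i j => inner ℝ (e.localFrame b i y) (e.localFrame b j y)
  let w : M → Fin (Module.finrank ℝ E) → ℝ := fun y i => inner ℝ (e.localFrame b i y) (W y)
  have hframe : ∀ i, ∀ᶠ y in nhds x, CMDiffAt ∞ (T% (e.localFrame b i)) y := fun i => by
    filter_upwards [e.open_baseSet.mem_nhds hx] with y hy
    exact contMDiffAt_localFrame_of_mem ∞ e b i hy
  have hG : ∀ i j, CMDiffAt ∞ (fun y => G y i j) x := fun i j =>
    ContMDiffAt.inner_bundle (F := E) (E := fun x : M => TangentSpace I x) (b := fun x => x)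
      (hframe i).self_of_nhds (hframe j).self_of_nhds
  have hw : ∀ i, CMDiffAt ∞ (fun y => w y i) x := fun i => h _ (hframe i)
  have hdet : ∀ A : M → Matrix (Fin (Module.finrank ℝ E)) (Fin (Module.finrank ℝ E)) ℝ,
      (∀ i j, CMDiffAt ∞ (fun y => A y i j) x) → CMDiffAt ∞ (fun y => (A y).det) x := by
    intro A hA
    simp only [Matrix.det_apply']
    exact contMDiffAt_finsetSum fun σ _ => contMDiffAt_const.mul
      (contMDiffAt_finsetProd fun i _ => hA _ _)
  have hne : ∀ y ∈ e.baseSet, (G y).det ≠ 0 := by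
    intro y hy h0
    obtain ⟨c, hc, h0⟩ := Matrix.exists_mulVec_eq_zero_iff.mpr h0
    have hv : ∑ j, c j • e.localFrame b j y = 0 := by
      refine inner_self_eq_zero (𝕜 := ℝ).mp ?_
      rw [sum_inner]
      refine Finset.sum_eq_zero fun i _ => ?_
      rw [inner_smul_left, inner_sum]
      have hi := congrFun h0 i
      simp only [Matrix.mulVec, dotProduct, G, Matrix.of_apply, Pi.zero_apply] at hi
      simp only [inner_smul_right, mul_comm (c _), hi, mul_zero]
    simp only [e.localFrame_apply_of_mem_baseSet b hy] at hv
    exact hc (funext (Fintype.linearIndependent_iff.mp (e.basisAt b hy).linearIndependent c hv))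
  rw [contMDiffAt_iff_localFrameCoeff b hx]
  intro i
  have hcr : CMDiffAt ∞ (fun y => (G y).det⁻¹ * (G y).cramer (w y) i) x := by
    simp only [Matrix.cramer_apply]
    refine ((hdet G hG).inv₀ (hne x hx)).mul (hdet _ fun j k => ?_)
    by_cases hk : k = i
    · subst hk
      simpa using hw j
    · simpa [Matrix.updateCol_apply, hk] using hG j k
  refine hcr.congr_of_eventuallyEq ?_
  filter_upwards [e.open_baseSet.mem_nhds hx] with y hy
  have hc : w y = (G y).mulVec fun j => e.localFrameCoeff I b j y (W y) := by
    funext j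
    simp only [w, G, Matrix.mulVec, dotProduct, Matrix.of_apply]
    conv_lhs => rw [e.eq_sum_localFrameCoeff_smul (I := I) (b := b) (s := W) hy]
    simp only [inner_sum, inner_smul_right, mul_comm]
  rw [hc, Matrix.cramer_eq_adjugate_mulVec, Matrix.mulVec_mulVec, Matrix.adjugate_mul,
    Matrix.smul_mulVec, Matrix.one_mulVec, Pi.smul_apply, smul_eq_mul,
    inv_mul_cancel_left₀ (hne y hy)]
  rfl

/-- Paired with a field Z smooth near the point, ∇_X Y gives the Koszul expression, which is smooth.
-/
theorem contMDiff_leviCivita {X Y : Π x : M, TangentSpace I x}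
    (hX : CMDiff ∞ (T% X)) (hY : CMDiff ∞ (T% Y)) :
    CMDiff ∞ (T% (fun x => leviCivita I M Y x (X x))) := by
  intro x
  refine contMDiffAt_of_inner fun Z hZ => ?_
  have hin : ∀ {V W : Π x : M, TangentSpace I x}, CMDiffAt ∞ (T% V) x → CMDiffAt ∞ (T% W) x →
      CMDiffAt ∞ (fun y => inner ℝ (V y) (W y)) x := fun hV hW =>
    ContMDiffAt.inner_bundle (F := E) (E := fun x : M => TangentSpace I x) (b := fun x => x) hV hW
  have hbr : ∀ {V W : Π x : M, TangentSpace I x}, CMDiffAt ∞ (T% V) x → CMDiffAt ∞ (T% W) x →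
      CMDiffAt ∞ (T% (mlieBracket I V W)) x := fun hV hW => by
    have : CompleteSpace E := FiniteDimensional.complete ℝ E
    have := isManifold_minSmoothness (I := I) (M := M) 2
    have : IsManifold I (∞ + 1) M := inferInstanceAs (IsManifold I ∞ M)
    exact ContMDiffAt.mlieBracket_vectorField (m := ⊤) (n := ⊤) hV hW (by simp)
  have hZx := hZ.self_of_nhds
  have hk : CMDiffAt ∞ (fun y => koszul X Y Z y) x := by
    unfold koszul
    exact contMDiffAt_const.mul ((((((contMDiffAt_mvfderiv_apply (hin (hY x) hZx) (hX x)).add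
      (contMDiffAt_mvfderiv_apply (hin (hX x) hZx) (hY x))).sub
      (contMDiffAt_mvfderiv_apply (hin (hX x) (hY x)) hZx)).add
      (hin (hbr (hX x) (hY x)) hZx)).sub (hin (hbr (hX x) hZx) (hY x))).sub
      (hin (hbr (hY x) hZx) (hX x)))
  refine hk.congr_of_eventuallyEq ?_
  filter_upwards [hZ] with y hy
  rw [← inner_leviCivita (hX.mdifferentiableAt (by simp)) (hY.mdifferentiableAt (by simp))
    (hy.mdifferentiableAt (by simp)), real_inner_comm]

end SmoothFields

/-! ### The manifold as an instance of the formal calculus, and the dimension argument -/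

section FieldAlgebra

variable {E : Type*} [NormedAddCommGroup E] [NormedSpace ℝ E]
  {H : Type*} [TopologicalSpace H] (I : ModelWithCorners ℝ E H)
  (M : Type*) [TopologicalSpace M] [ChartedSpace H M] [IsManifold I ∞ M]

/-- The smooth vector fields on `M`. -/
abbrev SmoothField : Type _ := Cₛ^∞⟮I; E, (fun x : M => TangentSpace I x)⟯

variable {I M}

instance SmoothField.instSMul : SMul C^∞⟮I, M; ℝ⟯ (SmoothField I M) where
  smul f X := ⟨fun x => f x • X x, f.contMDiff.smul_section X.contMDiff⟩

instance SmoothField.instModule : Module C^∞⟮I, M; ℝ⟯ (SmoothField I M) where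
  one_smul X := by ext x; exact one_smul ℝ (X x)
  mul_smul f g X := by ext x; exact mul_smul (f x) (g x) (X x)
  smul_zero f := by ext x; exact smul_zero (f x)
  smul_add f X Y := by ext x; exact smul_add (f x) (X x) (Y x)
  add_smul f g X := by ext x; exact add_smul (f x) (g x) (X x)
  zero_smul X := by ext x; exact zero_smul ℝ (X x)

instance ContMDiffMap.instIsAddTorsionFree : IsAddTorsionFree C^∞⟮I, M; ℝ⟯ where
  nsmul_right_injective n hn f g h := by
    ext x
    exact nsmul_right_injective hn (DFunLike.congr_fun h x)

theorem SmoothField.mdifferentiableAt (X : SmoothField I M) (x : M) :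
    MDiffAt (T% (fun y => X y)) x :=
  X.contMDiff.mdifferentiableAt (by simp)

theorem SmoothField.exists_apply_eq [FiniteDimensional ℝ E] [T2Space M] {x : M}
    (v : TangentSpace I x) : ∃ X : SmoothField I M, X x = v := by
  obtain ⟨X, hX, hv⟩ := exists_contMDiff_extend v
  exact ⟨⟨X, hX⟩, hv⟩

/-- The derivative of a smooth function along a smooth vector field. -/
def SmoothField.der (X : SmoothField I M) (f : C^∞⟮I, M; ℝ⟯) : C^∞⟮I, M; ℝ⟯ :=
  ⟨fun x => d% f x (X x), fun x => contMDiffAt_mvfderiv_apply (f.contMDiff x) (X.contMDiff x)⟩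

variable [FiniteDimensional ℝ E] [RiemannianBundle (fun x : M => TangentSpace I x)]
  [IsContMDiffRiemannianBundle I ∞ E (fun x : M => TangentSpace I x)]

/-- The covariant derivative of a smooth vector field along a smooth vector field. -/
def SmoothField.conn (X Y : SmoothField I M) : SmoothField I M :=
  ⟨fun x => leviCivita I M Y x (X x), contMDiff_leviCivita X.contMDiff Y.contMDiff⟩

omit [FiniteDimensional ℝ E] in
theorem SmoothField.contMDiff_inner (X Y : SmoothField I M) :
    CMDiff ∞ (fun x => inner ℝ (X x) (Y x)) :=
  ContMDiff.inner_bundle (F := E) (E := fun x : M => TangentSpace I x) (b := fun x => x)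
    X.contMDiff Y.contMDiff

/-- The metric as a bilinear form on smooth vector fields. -/
def SmoothField.metric : SmoothField I M →ₗ[C^∞⟮I, M; ℝ⟯] SmoothField I M →ₗ[C^∞⟮I, M; ℝ⟯]
    C^∞⟮I, M; ℝ⟯ :=
  LinearMap.mk₂ _ (fun X Y => ⟨fun x => inner ℝ (X x) (Y x), SmoothField.contMDiff_inner X Y⟩)
    (fun X X' Y => by ext x; exact inner_add_left (𝕜 := ℝ) (X x) (X' x) (Y x))
    (fun f X Y => by ext x; exact real_inner_smul_left (X x) (Y x) (f x))
    (fun X Y Y' => by ext x; exact inner_add_right (𝕜 := ℝ) (X x) (Y x) (Y' x))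
    (fun f X Y => by ext x; exact real_inner_smul_right (X x) (Y x) (f x))

theorem SmoothField.conn_sub_conn (X Y : SmoothField I M) (x : M) :
    (SmoothField.conn X Y - SmoothField.conn Y X) x = mlieBracket I X Y x :=
  leviCivita_torsion_free (X.mdifferentiableAt x) (Y.mdifferentiableAt x)

variable (I M) in
/-- The algebra of smooth vector fields with the Levi-Civita connection. -/
def SmoothField.algebra [T2Space M] : LeviCivitaAlgebra C^∞⟮I, M; ℝ⟯ (SmoothField I M) where
  der := SmoothField.der
  conn := SmoothField.conn
  metric := SmoothField.metric
  der_add X f f' := by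
    ext x
    exact congrArg (fun A => A (X x))
      (mvfderiv_add (f.contMDiff.mdifferentiableAt (by simp))
        (f'.contMDiff.mdifferentiableAt (by simp)))
  der_one X := by
    ext x
    exact congrArg (fun A => A (X x)) (mvfderiv_const (1 : ℝ))
  conn_add_left X X' Y := by ext x; exact map_add (leviCivita I M Y x) (X x) (X' x)
  conn_smul_left f X Y := by ext x; exact map_smul (leviCivita I M Y x) (f x) (X x)
  conn_add_right X Y Y' := by
    ext x
    exact congrArg (fun A => A (X x)) ((leviCivita I M).isCovariantDerivativeOn.add
      (Y.mdifferentiableAt x) (Y'.mdifferentiableAt x) (Set.mem_univ x))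
  conn_smul_right X f Y := by
    ext x
    refine (congrArg (fun A => A (X x)) ((leviCivita I M).isCovariantDerivativeOn.leibniz
      (Y.mdifferentiableAt x) (f.contMDiff.mdifferentiableAt (by simp)) (Set.mem_univ x))).trans ?_
    exact add_comm _ _
  metric_symm X Y := by ext x; exact real_inner_comm (Y x) (X x)
  metric_definite X hX := by
    ext x
    exact inner_self_eq_zero (𝕜 := ℝ).mp (DFunLike.congr_fun hX x)
  der_metric X Y Z := by
    ext x
    exact leviCivita_metric (Y.mdifferentiableAt x) (Z.mdifferentiableAt x) (X x)
  der_commutator X Y f := by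
    ext x
    refine (mvfderiv_mlieBracket X.contMDiff Y.contMDiff f.contMDiff x).trans ?_
    exact congrArg (d% f x) (SmoothField.conn_sub_conn X Y x).symm
  jacobi X Y Z := by
    have : CompleteSpace E := FiniteDimensional.complete ℝ E
    have := isManifold_minSmoothness (I := I) (M := M) 3
    have h2 : minSmoothness ℝ 2 ≤ (∞ : ℕ∞ω) := by
      rw [minSmoothness_of_isRCLikeNormedField]
      exact ENat.LEInfty.out
    ext x
    let br : SmoothField I M → SmoothField I M → SmoothField I M := fun X Y =>
      SmoothField.conn X Y - SmoothField.conn Y X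
    have hbr : ∀ X Y : SmoothField I M, ⇑(br X Y) = mlieBracket I X Y := fun X Y =>
      funext (SmoothField.conn_sub_conn X Y)
    have hneg : mlieBracket I Y (mlieBracket I Z X) x = -mlieBracket I Y (mlieBracket I X Z) x := by
      have hd := (br X Z).mdifferentiableAt x
      rw [hbr] at hd
      have h : mlieBracket I Z X = (-1 : ℝ) • mlieBracket I X Z := by
        rw [mlieBracket_swap, neg_one_smul]
      rw [h, mlieBracket_const_smul_right hd, neg_one_smul]
    have hJ := leibniz_identity_mlieBracket_apply (I := I) (x := x) ((X.contMDiff x).of_le h2)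
      ((Y.contMDiff x).of_le h2) ((Z.contMDiff x).of_le h2)
    have key : br X (br Y Z) x + br Y (br Z X) x + br Z (br X Y) x = 0 := by
      rw [hbr X, hbr Y, hbr Z, hbr Y, hbr Z, hbr X, hJ, hneg, mlieBracket_swap_apply (V := Z)]
      abel
    exact key

variable [T2Space M]

theorem exists_ne_zero_orthogonal {V : Type*} [NormedAddCommGroup V] [InnerProductSpace ℝ V]
    {n : ℕ} (hn : n < Module.finrank ℝ V) (v : Fin n → V) :
    ∃ u : V, u ≠ 0 ∧ ∀ i, inner ℝ u (v i) = 0 := by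
  have : FiniteDimensional ℝ V := Module.finite_of_finrank_pos (by omega)
  have h : Submodule.span ℝ (Set.range v) ≠ ⊤ := by
    intro h
    have h1 := finrank_range_le_card (R := ℝ) v
    rw [Set.finrank, h, finrank_top, Fintype.card_fin] at h1
    omega
  obtain ⟨u, hu, hu0⟩ := Submodule.exists_mem_ne_zero_of_ne_bot
    (mt (Submodule.orthogonal_eq_bot_iff (K := Submodule.span ℝ (Set.range v))).mp h)
  refine ⟨u, hu0, fun i => ?_⟩
  rw [real_inner_comm]
  exact hu _ (Submodule.subset_span ⟨i, rfl⟩)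

namespace AlmostContactMetricStructure

variable {S : AlmostContactMetricStructure I M}

variable (S) in
/-- The characteristic vector field as a smooth field. -/
def ξField : SmoothField I M := ⟨S.ξ, S.contMDiff_ξ⟩

variable (S) in
/-- The action of `φ` on smooth vector fields. -/
def φField : SmoothField I M →ₗ[C^∞⟮I, M; ℝ⟯] SmoothField I M where
  toFun X := ⟨fun x => S.φ x (X x),
    ContMDiff.clm_bundle_apply (F₁ := E) (F₂ := E) (E₁ := fun x : M => TangentSpace I x)
      (E₂ := fun x : M => TangentSpace I x) (b := fun x => x) S.contMDiff_φ X.contMDiff⟩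
  map_add' X Y := by ext x; exact map_add (S.φ x) (X x) (Y x)
  map_smul' f X := by ext x; exact map_smul (S.φ x) (f x) (X x)

/-- The algebra of smooth vector fields of a nearly Sasakian manifold. -/
def IsNearlySasakian.algebra (hS : S.IsNearlySasakian) :
    NearlySasakianAlgebra C^∞⟮I, M; ℝ⟯ (SmoothField I M) where
  toLeviCivitaAlgebra := SmoothField.algebra I M
  φ := S.φField
  ξ := S.ξField
  φ_sq X := by
    ext x
    refine (S.φ_sq x (X x)).trans ?_
    rw [S.η_eq]
    rfl
  metric_ξ_ξ := by ext x; exact S.inner_ξ_ξ x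
  φ_skew X Y := by ext x; exact S.φ_skew x (X x) (Y x)
  nearly X := by
    ext x
    refine (S.nablaφ_apply (X.mdifferentiableAt x) (X.mdifferentiableAt x)).symm.trans ?_
    refine (hS x (X x)).trans ?_
    rw [S.η_eq]
    rfl

/-- The only place where the dimension enters: five vectors at a point must leave room for a nonzero
orthogonal one. -/
theorem IsNearlySasakian.φ_h_eq_zero (hS : S.IsNearlySasakian) (hE : 5 < Module.finrank ℝ E)
    (Z : SmoothField I M) : hS.algebra.φ (hS.algebra.h Z) = 0 := by
  set N := hS.algebra
  wlog hZ : N.metric Z N.ξ = 0 generalizing Z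
  · have h := this (Z - N.metric Z N.ξ • N.ξ) (by simp [N.metric_ξ_ξ])
    simpa [N.h_ξ] using h
  ext x
  obtain ⟨u, hu0, hu⟩ := exists_ne_zero_orthogonal (V := TangentSpace I x) hE
    ![S.ξ x, Z x, N.φ Z x, N.h Z x, N.φ (N.h Z) x]
  obtain ⟨U, rfl⟩ := SmoothField.exists_apply_eq u
  have hUξ : inner ℝ (U x) (S.ξ x) = 0 := hu 0
  -- The identities require a field horizontal everywhere; removing the ξ-component achieves this
  -- without changing the value at `x`.
  let U' : SmoothField I M := U - N.metric U N.ξ • N.ξ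
  have hU'x : U' x = U x := by
    have h : U' x = U x - inner ℝ (U x) (S.ξ x) • S.ξ x := rfl
    rw [h, hUξ, zero_smul, sub_zero]
  have hU' : N.metric U' N.ξ = 0 := by simp [U', N.metric_ξ_ξ]
  have hev : ∀ V : SmoothField I M, inner ℝ (U x) (V x) = 0 →
      (ContMDiffMap.evalRingHom x) (N.metric U' V) = 0 := by
    intro V hV
    rw [← hU'x] at hV
    exact hV
  have h := N.mul_eq_zero_of_orthogonal (ContMDiffMap.evalRingHom x) hU' hZ (hev _ (hu 1))
    (hev _ (hu 2)) (hev _ (hu 3)) (hev _ (hu 4))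
  have h' : inner ℝ (U' x) (U' x)
      * inner ℝ (N.φ (N.h Z) x) (N.φ (N.h Z) x) = 0 := h
  rw [hU'x] at h'
  exact inner_self_eq_zero (𝕜 := ℝ).mp
    ((mul_eq_zero.mp h').resolve_left (mt inner_self_eq_zero.mp hu0))

theorem IsNearlySasakian.isSasakian (hS : S.IsNearlySasakian) (hE : 5 < Module.finrank ℝ E) :
    S.IsSasakian := by
  intro x v w
  obtain ⟨X, rfl⟩ := SmoothField.exists_apply_eq v
  obtain ⟨Y, rfl⟩ := SmoothField.exists_apply_eq w
  have h := hS.algebra.conn_φ X Y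
  rw [hS.algebra.defect_eq_zero (hS.φ_h_eq_zero hE), add_zero] at h
  have hx : leviCivita I M (fun y => S.φ y (Y y)) x (X x)
      = S.φ x (leviCivita I M Y x (X x)) + inner ℝ (X x) (Y x) • S.ξ x
        - inner ℝ (Y x) (S.ξ x) • X x := DFunLike.congr_fun h x
  rw [S.nablaφ_apply (X.mdifferentiableAt x) (Y.mdifferentiableAt x), hx, S.η_eq]
  abel

end AlmostContactMetricStructure

end FieldAlgebra

end

theorem mainTheorem1 {m : ℕ} (hm : 7 ≤ m)
    {M : Type*} [TopologicalSpace M] [T2Space M] [ChartedSpace (EuclideanSpace ℝ (Fin m)) M]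
    [IsManifold (𝓡 m) ∞ M]
    [RiemannianBundle (fun x : M => TangentSpace (𝓡 m) x)]
    [IsContMDiffRiemannianBundle (𝓡 m) ∞ (EuclideanSpace ℝ (Fin m))
      (fun x : M => TangentSpace (𝓡 m) x)]
    (S : AlmostContactMetricStructure (𝓡 m) M) (hS : S.IsNearlySasakian) :
    S.IsSasakian :=
  hS.isSasakian (by rw [finrank_euclideanSpace_fin]; omega)
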